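/- **Conventions.** For a cardinal $\theta$, $H(\theta)$ is the class of all sets whose transitive closure has size less than $\theta$, and $\prec$ denotes elementary submodel for the language of set theory $\{\in\}$. $\mathsf{ZFC}^-$ is $\mathsf{ZFC}$ without the power set axiom, with the collection scheme, and with choice in the form that every set can be well-ordered. Let $\kappa$ be an infinite cardinal. A *weak $\kappa$-model* is a (not necessarily transitive) set $M$ of size $\kappa$ such that $\kappa+1\subseteq M$ and $\langle M,\in\rangle\models\mathsf{ZFC}^-$. For a cardinal $\alpha$, $M$ is *closed under ${<}\alpha$-sequences* if every function from an ordinal $\gamma<\alpha$ to $M$ is an element of $M$. An elementary embedding $j\colon\langle M,\in\rangle\to\langle N,\in\rangle$, with $N$ a set, is *$\kappa$-powerset preserving* if it has critical point $\kappa$ (that is, $j(\xi)=\xi$ for all $\xi<\kappa$ and $j(\kappa)\neq\kappa$) and $M$ and $N$ have the same subsets of $\kappa$, that is, $\{x\in M\mid x\cap M\subseteq\kappa\}=\{x\in N\mid x\cap N\subseteq\kappa\}$. Let $\alpha\le\kappa$ be regular cardinals. $\kappa$ is *$\alpha$-Ramsey* if for arbitrarily large regular cardinals $\theta$, every $A\subseteq\kappa$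 is an element of some weak $\kappa$-model $M\prec H(\theta)$ that is closed under ${<}\alpha$-sequences and for which there is a $\kappa$-powerset preserving elementary embedding $j\colon M\to N$. A cardinal $\kappa$ is *Ramsey* if it is uncountable and $\kappa\to(\kappa)^{<\omega}_2$, that is, for every $f\colon[\kappa]^{<\omega}\to 2$ there is $X\subseteq\kappa$ of size $\kappa$ such that $f$ is constant on $[X]^n$ for every $n<\omega$. **Proposition.** If $\kappa$ is $\omega_1$-Ramsey, then $\kappa$ is a Ramsey cardinal and a limit of Ramsey cardinals; that is, $\kappa$ is Ramsey, and for every cardinal $\mu<\kappa$ there is a Ramsey cardinal $\nu$ with $\mu<\nu<\kappa$. -/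

import Mathlib

universe u

namespace LargeCardinal

open Cardinal FirstOrder

/-! ### First-order logic over sets of sets -/

/-- The only symbol of the language of set theory: a binary relation symbol. -/
inductive MemRel : ℕ → Type
  | mem : MemRel 2

/-- The first-order language of set theory. -/
def setLang : FirstOrder.Language.{0, 0} := ⟨fun _ => Empty, MemRel⟩

/-- A collection of sets, viewed as a first-order structure: the symbol is interpreted by the true
membership relation. This applies to `ZFSet`s and to classes `Set ZFSet` alike. -/
instance memStructure (p : ZFSet.{u} → Prop) : setLang.Structure (Subtype p) where
  funMap := fun f => Empty.elim f
  RelMap := fun r => match r with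
    | MemRel.mem => fun v => (v 0 : ZFSet.{u}) ∈ (v 1 : ZFSet.{u})

theorem relMap_mem {p : ZFSet.{u} → Prop} (v : Fin 2 → Subtype p) :
    FirstOrder.Language.Structure.RelMap (L := setLang) (M := Subtype p) (n := 2) MemRel.mem v ↔
      (v 0 : ZFSet.{u}) ∈ (v 1 : ZFSet.{u}) :=
  Iff.rfl

/-! ### Models of `ZFC` without the power set axiom -/

section ZFCMinus

variable {M : ZFSet.{u}}

/-- Inside `⟨M, ∈⟩`, `p` is the unordered pair `{a, b}`. -/
def IsUPairIn (p a b : M) : Prop :=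
  ∀ z : M, z.1 ∈ p.1 ↔ z = a ∨ z = b

/-- Inside `⟨M, ∈⟩`, `p` is the Kuratowski ordered pair `{{a}, {a, b}}`. -/
def IsOPairIn (p a b : M) : Prop :=
  ∃ s t : M, IsUPairIn s a a ∧ IsUPairIn t a b ∧ IsUPairIn p s t

/-- Inside `⟨M, ∈⟩`, the ordered pair of `a` and `b` belongs to `r`. -/
def RelatesIn (r a b : M) : Prop :=
  ∃ p : M, p.1 ∈ r.1 ∧ IsOPairIn p a b

/-- Inside `⟨M, ∈⟩`, the relation `r` is a strict well-order of the set `x`. -/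
structure WellOrdersIn (r x : M) : Prop where
  irrefl : ∀ a : M, a.1 ∈ x.1 → ¬ RelatesIn r a a
  trans : ∀ a b c : M, a.1 ∈ x.1 → b.1 ∈ x.1 → c.1 ∈ x.1 →
    RelatesIn r a b → RelatesIn r b c → RelatesIn r a c
  total : ∀ a b : M, a.1 ∈ x.1 → b.1 ∈ x.1 → RelatesIn r a b ∨ a = b ∨ RelatesIn r b a
  least : ∀ y : M, (∀ a : M, a.1 ∈ y.1 → a.1 ∈ x.1) → (∃ a : M, a.1 ∈ y.1) →
    ∃ m : M, m.1 ∈ y.1 ∧ ∀ b : M, b.1 ∈ y.1 → ¬ RelatesIn r b m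

end ZFCMinus

/-- `⟨M, ∈⟩ ⊨ ZFC⁻`, that is `ZFC` without power set, with the collection scheme; as usual in the
absence of power sets, choice is the statement that every set can be well-ordered. Single axioms
are written with quantifiers over `M`; the two schemes range over all first-order formulas with
parameters from `M`. -/
structure ModelsZFCMinus (M : ZFSet.{u}) : Prop where
  extensionality : ∀ x y : M, (∀ z : M, z.1 ∈ x.1 ↔ z.1 ∈ y.1) → x = y
  foundation : ∀ x : M, (∃ y : M, y.1 ∈ x.1) →
    ∃ y : M, y.1 ∈ x.1 ∧ ∀ z : M, ¬ (z.1 ∈ x.1 ∧ z.1 ∈ y.1)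
  pairing : ∀ a b : M, ∃ p : M, IsUPairIn p a b
  union : ∀ x : M, ∃ y : M, ∀ z : M, z.1 ∈ y.1 ↔ ∃ w : M, w.1 ∈ x.1 ∧ z.1 ∈ w.1
  infinity : ∃ w : M, (∃ e : M, e.1 ∈ w.1 ∧ ∀ z : M, z.1 ∉ e.1) ∧
    ∀ x : M, x.1 ∈ w.1 → ∃ y : M, y.1 ∈ w.1 ∧ ∀ z : M, z.1 ∈ y.1 ↔ z.1 ∈ x.1 ∨ z = x
  separation : ∀ (n : ℕ) (φ : setLang.Formula (Fin (n + 1))) (v : Fin n → M) (a : M),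
    ∃ b : M, ∀ x : M, x.1 ∈ b.1 ↔ x.1 ∈ a.1 ∧ φ.Realize (Fin.cons x v : Fin (n + 1) → M)
  collection : ∀ (n : ℕ) (φ : setLang.Formula (Fin (n + 2))) (v : Fin n → M) (a : M),
    (∀ x : M, x.1 ∈ a.1 →
      ∃ y : M, φ.Realize (Fin.cons x (Fin.cons y v : Fin (n + 1) → M) : Fin (n + 2) → M)) →
    ∃ b : M, ∀ x : M, x.1 ∈ a.1 →
      ∃ y : M, y.1 ∈ b.1 ∧
        φ.Realize (Fin.cons x (Fin.cons y v : Fin (n + 1) → M) : Fin (n + 2) → M)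
  choice : ∀ x : M, ∃ r : M, WellOrdersIn r x

/-! ### Weak `κ`-models and embeddings -/

/-- The cardinal `κ` as a set, namely as an initial von Neumann ordinal. -/
noncomputable def cardSet (κ : Cardinal.{u}) : ZFSet.{u} := κ.ord.toZFSet

/-- `H(θ)`, the class of all sets whose transitive closure has size less than `θ`. The transitive
closure of `x` is the least transitive set containing `x` as a subset, so it has size less than `θ`
iff some transitive superset of `x` has. -/
def H (θ : Cardinal.{u}) : Set ZFSet.{u} :=
  {x | ∃ t : ZFSet.{u}, t.IsTransitive ∧ x ⊆ t ∧ t.card < θ}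

/-- A weak `κ`-model: a (not necessarily transitive) set `M` of size `κ` with `κ + 1 ⊆ M` and
`⟨M, ∈⟩ ⊨ ZFC⁻`. -/
structure IsWeakModel (κ : Cardinal.{u}) (M : ZFSet.{u}) : Prop where
  card_eq : M.card = κ
  succ_subset : insert (cardSet κ) (cardSet κ) ⊆ M
  models : ModelsZFCMinus M

theorem IsWeakModel.cardSet_mem {κ : Cardinal.{u}} {M : ZFSet.{u}} (h : IsWeakModel κ M) :
    cardSet κ ∈ M :=
  h.succ_subset (ZFSet.mem_insert _ _)

/-- `M ≺ X`: `M` is a subset of `X` and the inclusion map is elementary. -/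
def IsElementarySubmodel (M : ZFSet.{u}) (X : Set ZFSet.{u}) : Prop :=
  ∃ i : M ↪ₑ[setLang] X, ∀ x : M, (i x : ZFSet.{u}) = x

/-- `M` is closed under `<α`-sequences: every function from an ordinal below `α` to `M`
is an element of `M`. -/
def ClosedUnderSeq (α : Cardinal.{u}) (M : ZFSet.{u}) : Prop :=
  ∀ γ < α.ord, ∀ f : ZFSet.{u}, ZFSet.IsFunc γ.toZFSet M f → f ∈ M

/-- The subsets of `κ` in the sense of `⟨M, ∈⟩`. For `M` transitive, or elementary in some `H(θ)`
and containing `κ`, these are just the elements of `M` that are subsets of `κ`. -/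
def subsetsIn (M : ZFSet.{u}) (κ : Cardinal.{u}) : Set ZFSet.{u} :=
  {x | x ∈ M ∧ ∀ y ∈ M, y ∈ x → y ∈ cardSet κ}

/-- The elementary embedding `j : M → N` of `∈`-structures is `κ`-powerset preserving: it has
critical point `κ` (all ordinals below `κ` are fixed and `κ` is moved), and `M` and `N` have the
same subsets of `κ`. -/
structure IsPowersetPreserving (κ : Cardinal.{u}) {M N : ZFSet.{u}}
    (j : M ↪ₑ[setLang] N) : Prop where
  fixes : ∀ x : M, x.1 ∈ cardSet κ → (j x : ZFSet.{u}) = x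
  moves : ∀ x : M, x.1 = cardSet κ → (j x : ZFSet.{u}) ≠ x
  same_subsets : subsetsIn M κ = subsetsIn N κ

/-! ### The large cardinal notions -/

/-- `κ` is `α`-Ramsey, where `α ≤ κ` are regular cardinals: for arbitrarily large regular `θ`, every
`A ⊆ κ` is an element of some weak `κ`-model `M ≺ H(θ)` that is closed under `<α`-sequences and
for which there is a `κ`-powerset preserving elementary embedding `j : M → N`. -/
structure IsAlphaRamsey (α κ : Cardinal.{u}) : Prop where
  regular_left : α.IsRegular
  regular : κ.IsRegular
  le : α ≤ κ
  exists_embedding : ∀ μ : Cardinal.{u}, ∃ θ : Cardinal.{u}, μ < θ ∧ θ.IsRegular ∧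
    ∀ A : ZFSet.{u}, A ⊆ cardSet κ →
      ∃ M : ZFSet.{u}, A ∈ M ∧ IsWeakModel κ M ∧ IsElementarySubmodel M (H θ) ∧
        ClosedUnderSeq α M ∧
        ∃ (N : ZFSet.{u}) (j : M ↪ₑ[setLang] N), IsPowersetPreserving κ j

/-- `κ` is a Ramsey cardinal: it is uncountable and `κ → (κ)^{<ω}_2`, i.e. for every colouring of
the finite subsets of `κ` in two colours there is a set `X ⊆ κ` of size `κ` such that, for each
`n`, all `n`-element subsets of `X` have the same colour. -/
def IsRamsey (κ : Cardinal.{u}) : Prop :=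
  ℵ₀ < κ ∧ ∀ f : Finset κ.ord.ToType → Bool, ∃ X : Set κ.ord.ToType, #X = κ ∧
    ∀ s t : Finset κ.ord.ToType, (s : Set κ.ord.ToType) ⊆ X → (t : Set κ.ord.ToType) ⊆ X →
      s.card = t.card → f s = f t

end LargeCardinal

/-!
Fix in `M` a pairing `⟨·, ·⟩` of the ordinals below `κ`, which `j` extends to `j(κ)`, and for
`F ⊆ κ` in `M` let `F' = {ξ < κ | ⟨ξ, κ⟩ ∈ j(F)}`. By powerset preservation `F'` is in `M` again,
so the derivative can be iterated, and countable closure of `M` puts the sequence `F, F', F'', …`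
into `M`. Call `a < κ` good if it is closed under the pairing and `⟨ξ, a⟩ ∈ F⁽ⁿ⁾ ↔ ξ ∈ F⁽ⁿ⁺¹⁾` for
all `n` and `ξ < a`. In `N` the ordinal `κ` is good for the image of the sequence, so the set `X` of
good ordinals is unbounded by elementarity. If `F` consists of the codes of the finite sets of one
colour, peeling off the largest element again and again shows that the colour of a finite subset of
`X` depends on its size alone.

So every `F` has such an `X`, and this is true in `N` as well as in `M`. As `κ < j(κ)`, elementarity
of `j` then gives ordinals `ν < κ` with the same property above every `μ < κ`. Applied to the
codes of a regressive function, the property shows that `ν` is regular, hence a Ramsey cardinal.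
-/

namespace LargeCardinal

open Cardinal Ordinal Set FirstOrder

/-! ### End-homogeneous sets of ordinals -/

/-- `π` is an injective coding `(ξ, a) ↦ π ξ a` of the pairs `ξ ≤ a < ν` by ordinals `≥ a`. -/
structure IsPairing (π : Ordinal.{u} → Ordinal.{u} → Ordinal.{u}) (ν : Ordinal.{u}) : Prop where
  le_apply : ∀ ⦃ξ a⦄, ξ ≤ a → a < ν → a ≤ π ξ a
  inj : ∀ ⦃ξ a η b⦄, ξ ≤ a → a < ν → η ≤ b → b < ν → π ξ a = π η b → ξ = η ∧ a = b

/-- The ordinal `a` is closed under the pairing `π`, and for every `k` the fiber over `a` of the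
`k`-th set of `G` agrees below `a` with the `(k + 1)`-st set. -/
structure EndHomogeneousAt (π : Ordinal.{u} → Ordinal.{u} → Ordinal.{u}) (G : ℕ → Set Ordinal.{u})
    (a : Ordinal.{u}) : Prop where
  omega_lt : ω < a
  closed : ∀ ⦃b⦄, b < a → ∀ ⦃ξ⦄, ξ ≤ b → π ξ b < a
  iff : ∀ k ⦃ξ⦄, ξ < a → ω ≤ ξ → (π ξ a ∈ G k ↔ ξ ∈ G (k + 1))

/-- An unbounded set `X ⊆ ν` is end-homogeneous for `F ⊆ ν`, as witnessed by the sequence `G` of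
iterated derivatives of `F`: whether a code of a descending sequence from `X` belongs to `F` can be
found by removing the entries of the sequence from the largest one on. -/
structure IsEndHomogeneousFor (π : Ordinal.{u} → Ordinal.{u} → Ordinal.{u}) (ν : Ordinal.{u})
    (F : Set Ordinal.{u}) (G : ℕ → Set Ordinal.{u}) (X : Set Ordinal.{u}) : Prop where
  subset : X ⊆ Iio ν
  exists_gt : ∀ ⦃b⦄, b < ν → ∃ a ∈ X, b < a
  at_mem : ∀ ⦃a⦄, a ∈ X → EndHomogeneousAt π G a
  zero_iff : ∀ ⦃ξ⦄, ξ < ν → ω ≤ ξ → (ξ ∈ G 0 ↔ ξ ∈ F)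

/-- The partition property of `ν` that yields homogeneous sets for colourings of finite sets: every
`F` has an end-homogeneous unbounded subset of `ν`. -/
def EndHomogeneous (π : Ordinal.{u} → Ordinal.{u} → Ordinal.{u}) (ν : Ordinal.{u}) : Prop :=
  ∀ F : Set Ordinal.{u}, ∃ G X, IsEndHomogeneousFor π ν F G X

variable {π : Ordinal.{u} → Ordinal.{u} → Ordinal.{u}} {ν : Ordinal.{u}}

theorem IsPairing.mono {o : Ordinal.{u}} (h : IsPairing π ν) (ho : o ≤ ν) : IsPairing π o where
  le_apply _ _ hξ ha := h.le_apply hξ (ha.trans_le ho)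
  inj _ _ _ _ hξ ha hη hb := h.inj hξ (ha.trans_le ho) hη (hb.trans_le ho)

theorem IsEndHomogeneousFor.apply_lt {F X : Set Ordinal.{u}} {G : ℕ → Set Ordinal.{u}}
    (h : IsEndHomogeneousFor π ν F G X) {ξ a : Ordinal.{u}} (hξ : ξ ≤ a) (ha : a < ν) :
    π ξ a < ν :=
  let ⟨_, hb, hab⟩ := h.exists_gt ha
  ((h.at_mem hb).closed hab hξ).trans (h.subset hb)

/-- The values of the regressive function `r` are coded by `F` in such a way that end-homogeneity
makes `r` constant on a final segment of `X`. -/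
theorem EndHomogeneous.exists_unbounded_fiber (h : EndHomogeneous π ν) (hπ : IsPairing π ν)
    {c : Ordinal.{u}} (hc : c < ν) (r : Iio ν → Iio c) : ∃ i, ∀ b, ∃ a > b, r a = i := by
  obtain ⟨G, X, hX⟩ := h {z | ∃ a : Iio ν, ∃ i < (r a).1,
    π i (max c ω) < a ∧ z = π (π i (max c ω)) a}
  obtain ⟨a₀, ha₀, -⟩ := hX.exists_gt hc
  have hd : max c ω < ν := max_lt hc ((hX.at_mem ha₀).omega_lt.trans (hX.subset ha₀))
  have key : ∀ a : Iio ν, a.1 ∈ X → max c ω < a.1 → ∀ i < c,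
      (i < (r a).1 ↔ π i (max c ω) ∈ G 1) := by
    intro a ha hda i hi
    have hid : i ≤ max c ω := hi.le.trans (le_max_left _ _)
    have hia : π i (max c ω) < a := (hX.at_mem ha).closed hda hid
    have hωi : ω ≤ π i (max c ω) := (le_max_right _ _).trans (hπ.le_apply hid hd)
    rw [← (hX.at_mem ha).iff 0 hia hωi, hX.zero_iff (hX.apply_lt hia.le a.2)
      ((hX.at_mem ha).omega_lt.le.trans (hπ.le_apply hia.le a.2))]
    refine ⟨fun hir => ⟨a, i, hir, hia, rfl⟩, ?_⟩
    rintro ⟨a', i', hi', hia', heq⟩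
    obtain ⟨hcode, haa'⟩ := hπ.inj hia.le a.2 hia'.le a'.2 heq
    obtain rfl := Subtype.ext haa'
    have hid' : i' ≤ max c ω := (hi'.trans (r a).2).le.trans (le_max_left _ _)
    rwa [(hπ.inj hid hd hid' hd hcode).1]
  obtain ⟨a₁, ha₁, hda₁⟩ := hX.exists_gt hd
  refine ⟨r ⟨a₁, hX.subset ha₁⟩, fun b => ?_⟩
  obtain ⟨a, ha, hba⟩ := hX.exists_gt (max_lt hd b.2)
  refine ⟨⟨a, hX.subset ha⟩, (le_max_right (max c ω) _).trans_lt hba, Subtype.ext ?_⟩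
  have hiff := key ⟨a, hX.subset ha⟩ ha ((le_max_left _ _).trans_lt hba)
  have hiff₁ := key ⟨a₁, hX.subset ha₁⟩ ha₁ hda₁
  refine le_antisymm (le_of_forall_lt fun i hi => ?_) (le_of_forall_lt fun i hi => ?_)
  · have hic := hi.trans (r _).2
    exact (hiff₁ i hic).2 ((hiff i hic).1 hi)
  · have hic := hi.trans (r _).2
    exact (hiff i hic).2 ((hiff₁ i hic).1 hi)

theorem EndHomogeneous.ord_cof (h : EndHomogeneous π ν) (hπ : IsPairing π ν) :
    ν.cof.ord = ν := by
  refine (ord_cof_le ν).antisymm (not_lt.1 fun hlt => ?_)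
  obtain ⟨f, hf⟩ := exists_isFundamentalSeq rfl
  have hcof : ∀ a : Iio ν, ∃ i, a ≤ f i := fun a =>
    let ⟨_, ⟨i, rfl⟩, hi⟩ := hf.isCofinal_range a
    ⟨i, hi⟩
  choose r hr using hcof
  obtain ⟨i, hi⟩ := h.exists_unbounded_fiber hπ hlt r
  obtain ⟨a, ha, rfl⟩ := hi (f i)
  exact ha.not_ge (hr a)

/-- `Codes π ν l x` says that `x` codes the descending list `l` of ordinals below `ν`; the first
entry of a list is its largest one, so decoding removes it first. -/
inductive Codes (π : Ordinal.{u} → Ordinal.{u} → Ordinal.{u}) (ν : Ordinal.{u}) :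
    List Ordinal.{u} → Ordinal.{u} → Prop
  | nil : Codes π ν [] ω
  | cons {l x a} : Codes π ν l x → ω < a → a < ν → x ≤ a → Codes π ν (a :: l) (π x a)

namespace Codes

variable {l : List Ordinal.{u}} {x : Ordinal.{u}}

theorem omega_lt_of_cons {a : Ordinal.{u}} (hπ : IsPairing π ν) (h : Codes π ν (a :: l) x) :
    ω < x := by
  cases h with
  | cons _ hω ha hxa => exact hω.trans_le (hπ.le_apply hxa ha)

theorem omega_le (hπ : IsPairing π ν) (h : Codes π ν l x) : ω ≤ x := by
  cases h with
  | nil => exact le_rfl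
  | cons h hω ha hxa => exact (omega_lt_of_cons hπ (h.cons hω ha hxa)).le

theorem injective (hπ : IsPairing π ν) {l' : List Ordinal.{u}} (h : Codes π ν l x)
    (h' : Codes π ν l' x) : l = l' := by
  induction h generalizing l' with
  | nil =>
    cases l' with
    | nil => rfl
    | cons b l' => exact absurd (omega_lt_of_cons hπ h') (lt_irrefl _)
  | @cons l y a h hω ha hya ih =>
    generalize hz : π y a = z at h'
    cases h' with
    | nil => exact absurd (omega_lt_of_cons hπ (h.cons hω ha hya)) hz.not_gt
    | cons h' _ hb hxb =>
      obtain ⟨rfl, rfl⟩ := hπ.inj hya ha hxb hb hz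
      rw [ih h']

theorem lt {G : ℕ → Set Ordinal.{u}} {a : Ordinal.{u}} (h : Codes π ν l x)
    (ha : EndHomogeneousAt π G a) (hl : ∀ b ∈ l, b < a) : x < a := by
  cases h with
  | nil => exact ha.omega_lt
  | cons _ _ _ hxb => exact ha.closed (hl _ (by simp)) hxb

end Codes

namespace IsEndHomogeneousFor

variable {F X : Set Ordinal.{u}} {G : ℕ → Set Ordinal.{u}}

theorem exists_codes (h : IsEndHomogeneousFor π ν F G X) (hπ : IsPairing π ν)
    {l : List Ordinal.{u}} (hl : l.Pairwise (· > ·)) (hlX : ∀ a ∈ l, a ∈ X) :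
    ∃ x, Codes π ν l x ∧ ∀ k, x ∈ G k ↔ ω ∈ G (k + l.length) := by
  induction l with
  | nil => exact ⟨ω, .nil, fun _ => Iff.rfl⟩
  | cons a l ih =>
    obtain ⟨hla, hl⟩ := List.pairwise_cons.1 hl
    obtain ⟨haX, hlX⟩ := List.forall_mem_cons.1 hlX
    obtain ⟨x, hx, hxG⟩ := ih hl hlX
    have ha := h.at_mem haX
    have hxa : x < a := hx.lt ha hla
    refine ⟨π x a, hx.cons ha.omega_lt (h.subset haX) hxa.le, fun k => ?_⟩
    rw [ha.iff k hxa (hx.omega_le hπ), hxG, List.length_cons, add_assoc, add_comm 1]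

theorem code_lt (h : IsEndHomogeneousFor π ν F G X) (hν : 0 < ν) {s : Finset Ordinal.{u}}
    (hs : (s : Set Ordinal.{u}) ⊆ X) {x : Ordinal.{u}} (hx : Codes π ν (s.sort (· ≥ ·)) x) :
    x < ν := by
  have hsup : s.sup id < ν := (Finset.sup_lt_iff hν).2 fun a ha => h.subset (hs ha)
  obtain ⟨a, ha, hlt⟩ := h.exists_gt hsup
  refine (hx.lt (h.at_mem ha) fun b hb => ?_).trans (h.subset ha)
  exact (Finset.le_sup (f := id) ((Finset.mem_sort _).1 hb)).trans_lt hlt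

end IsEndHomogeneousFor

namespace EndHomogeneous

theorem exists_homogeneous (h : EndHomogeneous π ν) (hπ : IsPairing π ν) (hν : 0 < ν)
    (f : Finset Ordinal.{u} → Bool) : ∃ X ⊆ Iio ν, (∀ b < ν, ∃ a ∈ X, b < a) ∧
      ∀ s t : Finset Ordinal.{u}, (s : Set Ordinal.{u}) ⊆ X → (t : Set Ordinal.{u}) ⊆ X →
        s.card = t.card → f s = f t := by
  obtain ⟨G, X, hX⟩ := h {z | ∃ s : Finset Ordinal.{u}, Codes π ν (s.sort (· ≥ ·)) z ∧ f s}
  have key (s : Finset Ordinal.{u}) (hs : (s : Set Ordinal.{u}) ⊆ X) :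
      f s ↔ ω ∈ G s.card := by
    obtain ⟨x, hx, hxG⟩ := hX.exists_codes hπ s.sortedGT_sort.pairwise
      fun a ha => hs ((Finset.mem_sort _).1 ha)
    have hx0 := hxG 0
    rw [zero_add, Finset.length_sort, hX.zero_iff (hX.code_lt hν hs hx) (hx.omega_le hπ)] at hx0
    rw [← hx0]
    refine ⟨fun hfs => ⟨s, hx, hfs⟩, ?_⟩
    rintro ⟨t, ht, hft⟩
    rwa [← s.sort_toFinset (· ≥ ·), hx.injective hπ ht, t.sort_toFinset]
  refine ⟨X, hX.subset, hX.exists_gt, fun s t hs ht hst => ?_⟩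
  rw [Bool.eq_iff_iff, key s hs, key t ht, hst]

theorem isRamsey {c : Cardinal.{u}} (h : EndHomogeneous π c.ord) (hπ : IsPairing π c.ord)
    (hc : 0 < c) : IsRamsey c := by
  have hc0 : 0 < c.ord := by simpa using hc
  refine ⟨?_, fun f => ?_⟩
  · obtain ⟨G, X, hX⟩ := h ∅
    obtain ⟨a, ha, -⟩ := hX.exists_gt hc0
    exact omega0_lt_ord.1 ((hX.at_mem ha).omega_lt.trans (hX.subset ha))
  let e : c.ord.ToType ↪o Ordinal.{u} :=
    ToType.mk.symm.toOrderEmbedding.trans (OrderEmbedding.subtype _)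
  have he (x : c.ord.ToType) : e x < c.ord := (ToType.mk.symm x).2
  obtain ⟨X, hXc, hub, hom⟩ := h.exists_homogeneous hπ hc0
    fun s => f (s.preimage e.toEmbedding e.injective.injOn)
  refine ⟨e ⁻¹' X, ((mk_set_le _).trans_eq (mk_ord_toType c)).antisymm ?_, fun s t hs ht hst => ?_⟩
  · have hcof : IsCofinal (e ⁻¹' X) := fun y => by
      obtain ⟨a, ha, hya⟩ := hub (e y) (he y)
      obtain ⟨x, rfl⟩ : ∃ x, e x = a := ⟨ToType.mk ⟨a, hXc ha⟩, by simp [e]⟩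
      exact ⟨x, ha, (e.lt_iff_lt.1 hya).le⟩
    have hle := Order.cof_le hcof
    rwa [cof_toType, ord_inj.1 (h.ord_cof hπ)] at hle
  · have := hom (s.map e.toEmbedding) (t.map e.toEmbedding) (by simpa using hs) (by simpa using ht)
      (by simpa using hst)
    simpa only [Finset.preimage_map] using this

end EndHomogeneous

theorem exists_isPairing {κ : Cardinal.{u}} (hκ : ℵ₀ ≤ κ) :
    ∃ π : Ordinal.{u} → Ordinal.{u} → Ordinal.{u}, IsPairing π κ.ord ∧
      ∀ ξ a, ξ ≤ a → a < κ.ord → π ξ a < κ.ord := by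
  have hlt {ξ a b : Ordinal.{u}} (hξ : ξ ≤ a) (hab : a < b) : a * a + ξ < b * b := calc
    a * a + ξ ≤ a * a + a := by gcongr
    _ < a * a + Order.succ a := by simp
    _ ≤ Order.succ a * a + Order.succ a := by gcongr; exact Order.le_succ a
    _ = Order.succ a * Order.succ a := (mul_succ _ _).symm
    _ ≤ b * b := by
      gcongr <;> exact Order.succ_le_of_lt hab
  refine ⟨fun ξ a => a * a + ξ, ⟨fun ξ a _ _ => ?_, ?_⟩, fun _ _ hξ ha => ?_⟩
  · obtain rfl | ha := eq_zero_or_pos a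
    · exact zero_le
    · exact (le_mul_left a ha).trans le_self_add
  · intro ξ a η b hξ _ hη _ heq
    obtain hab | rfl | hab := lt_trichotomy a b
    · exact absurd heq ((hlt hξ hab).trans_le le_self_add).ne
    · exact ⟨by simpa using heq, rfl⟩
    · exact absurd heq ((hlt hη hab).trans_le le_self_add).ne'
  · exact isPrincipal_add_ord hκ (isPrincipal_mul_ord hκ ha ha) (hξ.trans_lt ha)

/-! ### First-order predicates and elementary embeddings -/

/-- A predicate of tuples of elements of classes `q` is first-order if a single formula of the
language of set theory defines it in all the structures `⟨q, ∈⟩`. As a class, it is inferred from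
the shape of the predicate. -/
class IsFirstOrder {α : Type} (P : ∀ q : ZFSet.{u} → Prop, (α → Subtype q) → Prop) : Prop where
  exists_formula : ∃ φ : setLang.Formula α, ∀ q v, φ.Realize v ↔ P q v

/-- The true membership relation between the elements of a class. -/
instance membershipSubtype (q : ZFSet.{u} → Prop) : Membership (Subtype q) (Subtype q) :=
  ⟨fun y x => x.1 ∈ y.1⟩

namespace IsFirstOrder

variable {α : Type} {P Q : ∀ q : ZFSet.{u} → Prop, (α → Subtype q) → Prop}

instance mem (i j : α) : IsFirstOrder.{u} fun _ v => v i ∈ v j :=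
  let r : setLang.Relations 2 := MemRel.mem
  ⟨r.formula₂ (Language.Term.var i) (Language.Term.var j), fun _ _ =>
    Language.Formula.realize_rel₂.trans (relMap_mem _)⟩

instance eq (i j : α) : IsFirstOrder.{u} fun _ v => v i = v j :=
  ⟨(Language.Term.var i).equal (Language.Term.var j), fun _ _ => Language.Formula.realize_equal⟩

instance not [hP : IsFirstOrder P] : IsFirstOrder fun q v => ¬ P q v :=
  let ⟨φ, hφ⟩ := hP
  ⟨φ.not, fun q v => by rw [Language.Formula.realize_not, hφ]⟩

instance imp [hP : IsFirstOrder P] [hQ : IsFirstOrder Q] :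
    IsFirstOrder fun q v => P q v → Q q v :=
  let ⟨φ, hφ⟩ := hP
  let ⟨ψ, hψ⟩ := hQ
  ⟨φ.imp ψ, fun q v => by rw [Language.Formula.realize_imp, hφ, hψ]⟩

instance and [hP : IsFirstOrder P] [hQ : IsFirstOrder Q] :
    IsFirstOrder fun q v => P q v ∧ Q q v :=
  let ⟨φ, hφ⟩ := hP
  let ⟨ψ, hψ⟩ := hQ
  ⟨φ ⊓ ψ, fun q v => by rw [Language.Formula.realize_inf, hφ, hψ]⟩

instance or [hP : IsFirstOrder P] [hQ : IsFirstOrder Q] :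
    IsFirstOrder fun q v => P q v ∨ Q q v :=
  let ⟨φ, hφ⟩ := hP
  let ⟨ψ, hψ⟩ := hQ
  ⟨φ ⊔ ψ, fun q v => by rw [Language.Formula.realize_sup, hφ, hψ]⟩

instance iff [hP : IsFirstOrder P] [hQ : IsFirstOrder Q] :
    IsFirstOrder fun q v => (P q v ↔ Q q v) :=
  let ⟨φ, hφ⟩ := hP
  let ⟨ψ, hψ⟩ := hQ
  ⟨φ.iff ψ, fun q v => by rw [Language.Formula.realize_iff, hφ, hψ]⟩

instance all {R : ∀ q : ZFSet.{u} → Prop, (α → Subtype q) → Subtype q → Prop}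
    [hR : IsFirstOrder fun q (w : Option α → Subtype q) => R q (fun i => w (some i)) (w none)] :
    IsFirstOrder fun q v => ∀ x, R q v x := by
  obtain ⟨φ, hφ⟩ := hR
  let g : Option α → α ⊕ Unit := fun o => o.elim (.inr ()) .inl
  refine ⟨(φ.relabel g).iAlls Unit, fun q v => ?_⟩
  rw [Language.Formula.realize_iAlls]
  simp only [Language.Formula.realize_relabel, hφ]
  exact ⟨fun h x => h fun _ => x, fun h x => h (x ())⟩

instance ex {R : ∀ q : ZFSet.{u} → Prop, (α → Subtype q) → Subtype q → Prop}
    [hR : IsFirstOrder fun q (w : Option α → Subtype q) => R q (fun i => w (some i)) (w none)] :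
    IsFirstOrder fun q v => ∃ x, R q v x := by
  obtain ⟨φ, hφ⟩ : IsFirstOrder fun q v => ¬ ∀ x, ¬ R q v x := inferInstance
  exact ⟨φ, fun q v => (hφ q v).trans not_forall_not⟩

theorem map_iff (P : ∀ q : ZFSet.{u} → Prop, (α → Subtype q) → Prop) [hP : IsFirstOrder P]
    {q q' : ZFSet.{u} → Prop} (j : Subtype q ↪ₑ[setLang] Subtype q') (v : α → Subtype q) :
    P q v ↔ P q' (j ∘ v) := by
  obtain ⟨φ, hφ⟩ := hP
  rw [← hφ, ← hφ, j.map_formula]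

end IsFirstOrder

/-! ### End-homogeneity inside a class of sets -/

section Internal

variable {q : ZFSet.{u} → Prop}

/-- Inside `⟨q, ∈⟩`, `p` is the unordered pair `{a, b}`. -/
def IsUPair (p a b : Subtype q) : Prop := ∀ z, z ∈ p ↔ z = a ∨ z = b

/-- Inside `⟨q, ∈⟩`, `p` is the Kuratowski ordered pair of `a` and `b`. -/
def IsOPair (p a b : Subtype q) : Prop := ∃ s t, IsUPair s a a ∧ IsUPair t a b ∧ IsUPair p s t

/-- Inside `⟨q, ∈⟩`, the ordered pair of `a` and `b` belongs to `r`. -/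
def Relates (r a b : Subtype q) : Prop := ∃ p ∈ r, IsOPair p a b

/-- Inside `⟨q, ∈⟩`, the binary function `p` has value `z` at `(x, y)`. -/
def Maps (p x y z : Subtype q) : Prop := ∃ t, IsOPair t x y ∧ Relates p t z

/-- The relation `≤` between ordinals. -/
def MemOrEq (x y : Subtype q) : Prop := x ∈ y ∨ x = y

/-- Inside `⟨q, ∈⟩`, `a` is an ordinal: it is transitive, and so are its elements. -/
def IsOrd (a : Subtype q) : Prop :=
  (∀ x ∈ a, ∀ y ∈ x, y ∈ a) ∧ ∀ x ∈ a, ∀ y ∈ x, ∀ z ∈ y, z ∈ x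

/-- Inside `⟨q, ∈⟩`, `k'` is the successor `k ∪ {k}`. -/
def IsSucc (k' k : Subtype q) : Prop := ∀ x, x ∈ k' ↔ x ∈ k ∨ x = k

/-- `IsPairing` inside `⟨q, ∈⟩`, for a function `p` from pairs of elements of `c` to `c`. -/
def IsPairingIn (p c : Subtype q) : Prop :=
  (∀ a ∈ c, ∀ ξ, MemOrEq ξ a → ∃ z ∈ c, (∀ x ∈ a, x ∈ z) ∧ Maps p ξ a z ∧
    ∀ z', Maps p ξ a z' → z' = z) ∧
  ∀ a ∈ c, ∀ ξ, MemOrEq ξ a → ∀ b ∈ c, ∀ η, MemOrEq η b → ∀ z, Maps p ξ a z → Maps p η b z →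
    ξ = η ∧ a = b

/-- `EndHomogeneousAt` inside `⟨q, ∈⟩`, for a sequence `s`; here `w` stands for `ω`. -/
def EndHomogeneousAtIn (p w s a : Subtype q) : Prop :=
  w ∈ a ∧
  (∀ b ∈ a, ∀ ξ, MemOrEq ξ b → ∀ z, Maps p ξ b z → z ∈ a) ∧
  ∀ k ∈ w, ∀ k' ∈ w, IsSucc k' k → ∀ G G', Relates s k G → Relates s k' G' →
    ∀ ξ ∈ a, MemOrEq w ξ → ∀ z, Maps p ξ a z → (z ∈ G ↔ ξ ∈ G')

/-- `IsEndHomogeneousFor` inside `⟨q, ∈⟩`. -/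
def IsEndHomogeneousForIn (p w ν F s X : Subtype q) : Prop :=
  (∀ a ∈ X, a ∈ ν) ∧
  (∀ b ∈ ν, ∃ a ∈ X, b ∈ a) ∧
  (∀ a ∈ X, EndHomogeneousAtIn p w s a) ∧
  (∀ k ∈ w, ∃ G, Relates s k G) ∧
  ∀ e ∈ w, (∀ x, x ∉ e) → ∀ G, Relates s e G → ∀ ξ ∈ ν, MemOrEq w ξ → (ξ ∈ G ↔ ξ ∈ F)

/-- `EndHomogeneous` inside `⟨q, ∈⟩`. -/
def EndHomogeneousIn (p w ν : Subtype q) : Prop :=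
  ∀ F, (∀ x ∈ F, x ∈ ν) → ∃ s X, IsEndHomogeneousForIn p w ν F s X

theorem IsPairingIn.maps_unique {p c a ξ z z' : Subtype q} (h : IsPairingIn p c) (ha : a ∈ c)
    (hξ : MemOrEq ξ a) (hz : Maps p ξ a z) (hz' : Maps p ξ a z') : z = z' :=
  let ⟨_, _, _, _, huniq⟩ := h.1 a ha ξ hξ
  (huniq z hz).trans (huniq z' hz').symm

end Internal

namespace IsFirstOrder

variable {α : Type}

instance isUPair (p a b : α) : IsFirstOrder.{u} fun _ v => IsUPair (v p) (v a) (v b) := by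
  unfold IsUPair; infer_instance

instance isOPair (p a b : α) : IsFirstOrder.{u} fun _ v => IsOPair (v p) (v a) (v b) := by
  unfold IsOPair; infer_instance

instance relates (r a b : α) : IsFirstOrder.{u} fun _ v => Relates (v r) (v a) (v b) := by
  unfold Relates; infer_instance

instance maps (p x y z : α) : IsFirstOrder.{u} fun _ v => Maps (v p) (v x) (v y) (v z) := by
  unfold Maps; infer_instance

instance memOrEq (x y : α) : IsFirstOrder.{u} fun _ v => MemOrEq (v x) (v y) := by
  unfold MemOrEq; infer_instance

instance isOrd (a : α) : IsFirstOrder.{u} fun _ v => IsOrd (v a) := by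
  unfold IsOrd; infer_instance

instance isSucc (k' k : α) : IsFirstOrder.{u} fun _ v => IsSucc (v k') (v k) := by
  unfold IsSucc; infer_instance

instance isPairingIn (p c : α) : IsFirstOrder.{u} fun _ v => IsPairingIn (v p) (v c) := by
  unfold IsPairingIn; infer_instance

instance endHomogeneousAtIn (p w s a : α) :
    IsFirstOrder.{u} fun _ v => EndHomogeneousAtIn (v p) (v w) (v s) (v a) := by
  unfold EndHomogeneousAtIn; infer_instance

instance isEndHomogeneousForIn (p w ν F s X : α) : IsFirstOrder.{u} fun _ v =>
    IsEndHomogeneousForIn (v p) (v w) (v ν) (v F) (v s) (v X) := by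
  unfold IsEndHomogeneousForIn; infer_instance

instance endHomogeneousIn (p w ν : α) :
    IsFirstOrder.{u} fun _ v => EndHomogeneousIn (v p) (v w) (v ν) := by
  unfold EndHomogeneousIn; infer_instance

end IsFirstOrder

section Transfer

variable {q q' : ZFSet.{u} → Prop} (j : Subtype q ↪ₑ[setLang] Subtype q')

theorem map_mem_map_iff {a b : Subtype q} : j a ∈ j b ↔ a ∈ b :=
  (IsFirstOrder.map_iff (fun q (v : Fin 2 → Subtype q) => v 0 ∈ v 1) j ![a, b]).symm

theorem relates_map_iff {r a b : Subtype q} : Relates (j r) (j a) (j b) ↔ Relates r a b :=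
  (IsFirstOrder.map_iff (fun q (v : Fin 3 → Subtype q) => Relates (v 0) (v 1) (v 2)) j
    ![r, a, b]).symm

theorem maps_map_iff {p x y z : Subtype q} : Maps (j p) (j x) (j y) (j z) ↔ Maps p x y z :=
  (IsFirstOrder.map_iff (fun q (v : Fin 4 → Subtype q) => Maps (v 0) (v 1) (v 2) (v 3)) j
    ![p, x, y, z]).symm

theorem isOrd_map_iff {a : Subtype q} : IsOrd (j a) ↔ IsOrd a :=
  (IsFirstOrder.map_iff (fun q (v : Fin 1 → Subtype q) => IsOrd (v 0)) j ![a]).symm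

theorem isSucc_map_iff {k' k : Subtype q} : IsSucc (j k') (j k) ↔ IsSucc k' k :=
  (IsFirstOrder.map_iff (fun q (v : Fin 2 → Subtype q) => IsSucc (v 0) (v 1)) j ![k', k]).symm

theorem isPairingIn_map_iff {p c : Subtype q} : IsPairingIn (j p) (j c) ↔ IsPairingIn p c :=
  (IsFirstOrder.map_iff (fun q (v : Fin 2 → Subtype q) => IsPairingIn (v 0) (v 1)) j
    ![p, c]).symm

theorem isEndHomogeneousForIn_map_iff {p w ν F s X : Subtype q} :
    IsEndHomogeneousForIn (j p) (j w) (j ν) (j F) (j s) (j X) ↔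
      IsEndHomogeneousForIn p w ν F s X :=
  (IsFirstOrder.map_iff (fun q (v : Fin 6 → Subtype q) =>
    IsEndHomogeneousForIn (v 0) (v 1) (v 2) (v 3) (v 4) (v 5)) j ![p, w, ν, F, s, X]).symm

theorem endHomogeneousIn_map_iff {p w ν : Subtype q} :
    EndHomogeneousIn (j p) (j w) (j ν) ↔ EndHomogeneousIn p w ν :=
  (IsFirstOrder.map_iff (fun q (v : Fin 3 → Subtype q) => EndHomogeneousIn (v 0) (v 1) (v 2)) j
    ![p, w, ν]).symm

end Transfer

/-! ### Evaluation in `H(θ)` -/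

section Ordinals

open ZFSet

variable {q : ZFSet.{u} → Prop} {a o : Ordinal.{u}} {x y : Subtype q}

theorem mem_iff_lt (hx : x.1 = a.toZFSet) (hy : y.1 = o.toZFSet) : x ∈ y ↔ a < o := by
  change x.1 ∈ y.1 ↔ a < o
  rw [hx, hy, toZFSet_mem_toZFSet_iff]

theorem memOrEq_iff_le (hx : x.1 = a.toZFSet) (hy : y.1 = o.toZFSet) : MemOrEq x y ↔ a ≤ o := by
  rw [MemOrEq, mem_iff_lt hx hy, Subtype.ext_iff, hx, hy, toZFSet_injective.eq_iff,
    le_iff_lt_or_eq]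

theorem exists_lt_of_mem (hy : y.1 = o.toZFSet) (h : x ∈ y) : ∃ a < o, x.1 = a.toZFSet :=
  let ⟨a, ha, hax⟩ := mem_toZFSet_iff.1 (hy ▸ h : x.1 ∈ o.toZFSet)
  ⟨a, ha, hax.symm⟩

theorem exists_le_of_memOrEq (hy : y.1 = o.toZFSet) (h : MemOrEq x y) :
    ∃ a ≤ o, x.1 = a.toZFSet := by
  obtain h | rfl := h
  · obtain ⟨a, ha, hx⟩ := exists_lt_of_mem hy h
    exact ⟨a, ha.le, hx⟩
  · exact ⟨o, le_rfl, hy⟩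

theorem exists_nat_of_mem (hy : y.1 = toZFSet ω) (h : x ∈ y) : ∃ n : ℕ, x.1 = toZFSet n := by
  obtain ⟨a, ha, hx⟩ := exists_lt_of_mem hy h
  obtain ⟨n, rfl⟩ := lt_omega0.1 ha
  exact ⟨n, hx⟩

theorem IsSucc.eq_add_one (hx : x.1 = a.toZFSet) (hy : y.1 = o.toZFSet) (h : IsSucc y x)
    (hq : q (a + 1).toZFSet) : o = a + 1 := by
  have hao : a < o := (mem_iff_lt hx hy).1 ((h x).2 (.inr rfl))
  refine le_antisymm (le_of_not_gt fun hlt => ?_) (Order.add_one_le_of_lt hao)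
  have := (memOrEq_iff_le rfl hx).1 ((h ⟨_, hq⟩).1 ((mem_iff_lt rfl hy).2 hlt))
  exact (Order.lt_add_one_iff.2 le_rfl).not_ge this

end Ordinals

/-- The closure properties of `H(θ)` for infinite `θ`. -/
structure Ambient (q : ZFSet.{u} → Prop) : Prop where
  of_mem : ∀ ⦃x y : ZFSet.{u}⦄, x ∈ y → q y → q x
  of_subset : ∀ ⦃x y : ZFSet.{u}⦄, x ⊆ y → q y → q x
  prod : ∀ ⦃x y : ZFSet.{u}⦄, q x → q y → q (x.prod y)

theorem exists_isTransitive_pairs {θ : Cardinal.{u}} (hθ : ℵ₀ ≤ θ) {t : ZFSet.{u}}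
    (ht : t.IsTransitive) (hc : t.card < θ) : ∃ t' : ZFSet.{u}, t'.IsTransitive ∧ t'.card < θ ∧
      ∀ x ∈ t, ∀ y ∈ t, ({x, y} : ZFSet.{u}) ∈ t' := by
  let P : ZFSet.{u} := ZFSet.range fun x : t × t => ({x.1.1, x.2.1} : ZFSet.{u})
  have hP : P.card ≤ t.card * t.card := by
    have := ZFSet.lift_card_range_le (f := fun x : t × t => ({x.1.1, x.2.1} : ZFSet.{u}))
    rwa [← mul_def, ZFSet.cardinalMk_coe_sort, ← Cardinal.lift_mul,
      Cardinal.lift_id'.{u, u + 1}, Cardinal.lift_le] at this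
  refine ⟨t ∪ P, fun z hz w hw => ?_, ?_, fun x hx y hy => ?_⟩
  · rw [ZFSet.mem_union] at hz ⊢
    refine .inl ?_
    obtain hz | hz := hz
    · exact ht.mem_trans hw hz
    · obtain ⟨⟨x, y⟩, rfl⟩ := ZFSet.mem_range.1 hz
      obtain rfl | rfl := ZFSet.mem_pair.1 hw
      exacts [x.2, y.2]
  · exact ZFSet.card_union_le.trans_lt
      (add_lt_of_lt hθ hc (hP.trans_lt (mul_lt_of_lt hθ hc hc)))
  · exact ZFSet.mem_union.2 (.inr (ZFSet.mem_range.2 ⟨(⟨x, hx⟩, ⟨y, hy⟩), rfl⟩))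

theorem ambient_H {θ : Cardinal.{u}} (hθ : ℵ₀ ≤ θ) : Ambient (· ∈ H θ) where
  of_mem := fun x y hxy ⟨t, ht, hyt, hc⟩ => ⟨t, ht, ht x (hyt hxy), hc⟩
  of_subset := fun x y hxy ⟨t, ht, hyt, hc⟩ => ⟨t, ht, fun _ hz => hyt (hxy hz), hc⟩
  prod := by
    rintro x y ⟨t₁, ht₁, hxt, hc₁⟩ ⟨t₂, ht₂, hyt, hc₂⟩
    obtain ⟨t', ht', hc', hpair⟩ := exists_isTransitive_pairs hθ (ht₁.union ht₂)
      (ZFSet.card_union_le.trans_lt (add_lt_of_lt hθ hc₁ hc₂))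
    obtain ⟨t'', ht'', hc'', hpair'⟩ := exists_isTransitive_pairs hθ ht' hc'
    refine ⟨t'', ht'', fun z hz => ?_, hc''⟩
    obtain ⟨a, ha, b, hb, rfl⟩ := ZFSet.mem_prod.1 hz
    have ha' := ZFSet.mem_union.2 (.inl (hxt ha) : a ∈ t₁ ∨ a ∈ t₂)
    have hb' := ZFSet.mem_union.2 (.inr (hyt hb) : b ∈ t₁ ∨ b ∈ t₂)
    rw [ZFSet.pair, ← ZFSet.pair_eq_singleton]
    exact hpair' _ (hpair a ha' a ha') _ (hpair a ha' b hb')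

/-- Inside `⟨q, ∈⟩`, the function `p` computes `π` at the pairs `ξ ≤ a < ν`. -/
def Computes {q : ZFSet.{u} → Prop} (p : Subtype q)
    (π : Ordinal.{u} → Ordinal.{u} → Ordinal.{u}) (ν : Ordinal.{u}) : Prop :=
  ∀ ⦃ξ a⦄, ξ ≤ a → a < ν → ∀ ⦃x y : Subtype q⦄, x.1 = ξ.toZFSet → y.1 = a.toZFSet →
    ∃ z, z.1 = (π ξ a).toZFSet ∧ Maps p x y z

namespace Ambient

open ZFSet

variable {q : ZFSet.{u} → Prop} (h : Ambient q)
include h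

theorem of_lt {a o : Ordinal.{u}} (ha : a < o) {x : Subtype q} (hx : x.1 = o.toZFSet) :
    q a.toZFSet :=
  h.of_mem (hx ▸ toZFSet_mem_toZFSet_iff.2 ha) x.2

theorem isUPair_iff {p a b : Subtype q} : IsUPair p a b ↔ p.1 = {a.1, b.1} := by
  constructor
  · intro hp
    ext z
    rw [ZFSet.mem_pair]
    constructor
    · intro hz
      exact ((hp ⟨z, h.of_mem hz p.2⟩).1 hz).imp (congrArg Subtype.val) (congrArg Subtype.val)
    · rintro (rfl | rfl)
      · exact (hp a).2 (.inl rfl)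
      · exact (hp b).2 (.inr rfl)
  · intro hp z
    change z.1 ∈ p.1 ↔ _
    rw [hp, ZFSet.mem_pair, Subtype.ext_iff, Subtype.ext_iff]

theorem isOPair_iff {p a b : Subtype q} : IsOPair p a b ↔ p.1 = pair a.1 b.1 := by
  constructor
  · rintro ⟨s, t, hs, ht, hp⟩
    rw [h.isUPair_iff] at hs ht hp
    rw [hp, hs, ht, pair, ZFSet.pair_eq_singleton]
  · intro hp
    rw [pair, ← ZFSet.pair_eq_singleton] at hp
    have hs : ({a.1, a.1} : ZFSet) ∈ p.1 := hp ▸ ZFSet.mem_pair.2 (.inl rfl)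
    have ht : ({a.1, b.1} : ZFSet) ∈ p.1 := hp ▸ ZFSet.mem_pair.2 (.inr rfl)
    exact ⟨⟨_, h.of_mem hs p.2⟩, ⟨_, h.of_mem ht p.2⟩, h.isUPair_iff.2 rfl, h.isUPair_iff.2 rfl,
      h.isUPair_iff.2 hp⟩

theorem relates_iff {r a b : Subtype q} : Relates r a b ↔ pair a.1 b.1 ∈ r.1 := by
  constructor
  · rintro ⟨p, hp, hab⟩
    rwa [← h.isOPair_iff.1 hab]
  · intro hp
    exact ⟨⟨_, h.of_mem hp r.2⟩, hp, h.isOPair_iff.2 rfl⟩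

theorem maps_iff {p x y z : Subtype q} : Maps p x y z ↔ pair (pair x.1 y.1) z.1 ∈ p.1 := by
  constructor
  · rintro ⟨t, ht, hp⟩
    rwa [h.relates_iff, h.isOPair_iff.1 ht] at hp
  · intro hp
    have hs : ({pair x.1 y.1} : ZFSet) ∈ pair (pair x.1 y.1) z.1 := ZFSet.mem_pair.2 (.inl rfl)
    have hq : q (pair x.1 y.1) :=
      h.of_mem (ZFSet.mem_singleton.2 rfl) (h.of_mem hs (h.of_mem hp p.2))
    exact ⟨⟨_, hq⟩, h.isOPair_iff.2 rfl, h.relates_iff.2 hp⟩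

theorem isOrd_iff {a : Subtype q} : IsOrd a ↔ a.1.IsOrdinal := by
  rw [isOrdinal_iff_forall_mem_isTransitive]
  constructor
  · rintro ⟨h1, h2⟩
    have hq : ∀ {x : ZFSet}, x ∈ a.1 → q x := fun hx => h.of_mem hx a.2
    refine ⟨fun x hx y hy => h1 ⟨x, hq hx⟩ hx ⟨y, h.of_mem hy (hq hx)⟩ hy, ?_⟩
    intro x hx y hy z hz
    exact h2 ⟨x, hq hx⟩ hx ⟨y, h.of_mem hy (hq hx)⟩ hy
      ⟨z, h.of_mem hz (h.of_mem hy (hq hx))⟩ hz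
  · rintro ⟨h1, h2⟩
    exact ⟨fun x hx y hy => h1 _ hx hy, fun x hx y hy z hz => h2 _ hx _ hy hz⟩

theorem exists_sep (P : Subtype q → Prop) (c : Subtype q) :
    ∃ b : Subtype q, ∀ x, x ∈ b ↔ x ∈ c ∧ P x := by
  refine ⟨⟨ZFSet.sep (fun x => ∃ hx, P ⟨x, hx⟩) c.1, h.of_subset ZFSet.sep_subset c.2⟩, ?_⟩
  intro x
  change x.1 ∈ ZFSet.sep (fun x => ∃ hx, P ⟨x, hx⟩) c.1 ↔ _
  exact ZFSet.mem_sep.trans <| and_congr_right fun _ => ⟨fun ⟨_, hP⟩ => hP, fun hP => ⟨x.2, hP⟩⟩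

theorem exists_isPairingIn {κ : Cardinal.{u}} (hκ : ℵ₀ ≤ κ) {c : Subtype q}
    (hc : c.1 = cardSet κ) : ∃ p, IsPairingIn p c := by
  obtain ⟨π, hπ, hlt⟩ := exists_isPairing hκ
  let g : ZFSet.{u} := ZFSet.sep (fun t => ∃ ξ a : Ordinal.{u},
    t = pair (pair ξ.toZFSet a.toZFSet) (π ξ a).toZFSet) ((c.1.prod c.1).prod c.1)
  have hq : q g := h.of_subset ZFSet.sep_subset (h.prod (h.prod c.2 c.2) c.2)
  have hmaps {ξ a : Ordinal.{u}} (hξ : ξ ≤ a) (ha : a < κ.ord) {x y : Subtype q}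
      (hx : x.1 = ξ.toZFSet) (hy : y.1 = a.toZFSet) (z : Subtype q) :
      Maps ⟨g, hq⟩ x y z ↔ z.1 = (π ξ a).toZFSet := by
    rw [h.maps_iff, hx, hy, ZFSet.mem_sep, pair_mem_prod, pair_mem_prod, hc, cardSet]
    constructor
    · rintro ⟨-, η, b, heq⟩
      obtain ⟨h₁, h₂⟩ := pair_inj.1 heq
      obtain ⟨hη, hb⟩ := pair_inj.1 h₁
      rw [h₂, toZFSet_injective hη, toZFSet_injective hb]
    · intro hz
      rw [hz]
      simp only [toZFSet_mem_toZFSet_iff]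
      exact ⟨⟨⟨hξ.trans_lt ha, ha⟩, hlt ξ a hξ ha⟩, ξ, a, rfl⟩
  refine ⟨⟨g, hq⟩, fun y hy x hx => ?_, ?_⟩
  · obtain ⟨a, ha, hya⟩ := exists_lt_of_mem hc hy
    obtain ⟨ξ, hξ, hxξ⟩ := exists_le_of_memOrEq hya hx
    refine ⟨⟨_, h.of_lt (hlt ξ a hξ ha) hc⟩, (mem_iff_lt rfl hc).2 (hlt ξ a hξ ha), ?_,
      (hmaps hξ ha hxξ hya _).2 rfl, fun z' hz' => ?_⟩
    · intro b hb
      obtain ⟨β, hβ, hbβ⟩ := exists_lt_of_mem hya hb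
      exact (mem_iff_lt hbβ rfl).2 (hβ.trans_le (hπ.le_apply hξ ha))
    · exact Subtype.ext ((hmaps hξ ha hxξ hya z').1 hz')
  · intro y hy x hx y' hy' x' hx' z hz hz'
    obtain ⟨a, ha, hya⟩ := exists_lt_of_mem hc hy
    obtain ⟨ξ, hξ, hxξ⟩ := exists_le_of_memOrEq hya hx
    obtain ⟨b, hb, hyb⟩ := exists_lt_of_mem hc hy'
    obtain ⟨η, hη, hxη⟩ := exists_le_of_memOrEq hyb hx'
    rw [hmaps hξ ha hxξ hya] at hz
    rw [hmaps hη hb hxη hyb] at hz'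
    obtain ⟨rfl, rfl⟩ := hπ.inj hξ ha hη hb (toZFSet_injective (hz.symm.trans hz'))
    exact ⟨Subtype.ext (hxξ.trans hxη.symm), Subtype.ext (hya.trans hyb.symm)⟩

theorem exists_computes {ν : Ordinal.{u}} {p c : Subtype q} (hc : c.1 = ν.toZFSet)
    (hp : IsPairingIn p c) :
    ∃ π : Ordinal.{u} → Ordinal.{u} → Ordinal.{u}, IsPairing π ν ∧ Computes p π ν := by
  have hval (ξ a : Ordinal.{u}) (hξ : ξ ≤ a) (ha : a < ν) : ∃ b, a ≤ b ∧
      ∀ ⦃x y : Subtype q⦄, x.1 = ξ.toZFSet → y.1 = a.toZFSet →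
        ∃ z, z.1 = b.toZFSet ∧ Maps p x y z := by
    have hya : q a.toZFSet := h.of_lt ha hc
    have hxξ : q ξ.toZFSet := h.of_lt (hξ.trans_lt ha) hc
    obtain ⟨z, hz, hyz, hmaps, -⟩ := hp.1 ⟨_, hya⟩ ((mem_iff_lt rfl hc).2 ha) ⟨_, hxξ⟩
      ((memOrEq_iff_le rfl rfl).2 hξ)
    obtain ⟨b, -, hzb⟩ := exists_lt_of_mem hc hz
    refine ⟨b, le_of_forall_lt fun e he => ?_, fun x y hx hy => ⟨z, hzb, ?_⟩⟩
    · exact (mem_iff_lt rfl hzb).1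
        (hyz ⟨_, h.of_lt (he.trans ha) hc⟩ ((mem_iff_lt rfl rfl).2 he))
    · rwa [show x = ⟨_, hxξ⟩ from Subtype.ext hx, show y = ⟨_, hya⟩ from Subtype.ext hy]
  choose! π hle hπ using hval
  refine ⟨π, ⟨hle, fun ξ a η b hξ ha hη hb heq => ?_⟩, hπ⟩
  have hq {o : Ordinal.{u}} (ho : o < ν) : q o.toZFSet := h.of_lt ho hc
  obtain ⟨z, hz, hmaps⟩ := hπ _ _ hξ ha (x := ⟨_, hq (hξ.trans_lt ha)⟩) (y := ⟨_, hq ha⟩) rfl rfl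
  obtain ⟨z', hz', hmaps'⟩ := hπ _ _ hη hb (x := ⟨_, hq (hη.trans_lt hb)⟩) (y := ⟨_, hq hb⟩) rfl rfl
  obtain rfl : z = z' := Subtype.ext (by rw [hz, hz', heq])
  have := hp.2 _ ((mem_iff_lt rfl hc).2 ha) _ ((memOrEq_iff_le rfl rfl).2 hξ) _
    ((mem_iff_lt rfl hc).2 hb) _ ((memOrEq_iff_le rfl rfl).2 hη) z hmaps hmaps'
  simpa only [Subtype.mk.injEq, toZFSet_injective.eq_iff] using this

theorem endHomogeneousAt {ν o : Ordinal.{u}} {p w s a : Subtype q} (hp : Computes p π ν)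
    (ho : o < ν) (ha : a.1 = o.toZFSet) (hw : w.1 = toZFSet ω) {G : ℕ → Subtype q}
    (hG : ∀ (n : ℕ) (k : Subtype q), k.1 = (n : Ordinal.{u}).toZFSet → Relates s k (G n))
    (hs : EndHomogeneousAtIn p w s a) :
    EndHomogeneousAt π (fun n => {ξ | ξ.toZFSet ∈ (G n).1}) o := by
  obtain ⟨hwa, hclosed, hiff⟩ := hs
  have hnat (n : ℕ) : q (n : Ordinal.{u}).toZFSet := h.of_lt (natCast_lt_omega0 n) hw
  have hmem_w (n : ℕ) : ⟨_, hnat n⟩ ∈ w := (mem_iff_lt rfl hw).2 (natCast_lt_omega0 n)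
  refine ⟨(mem_iff_lt hw ha).1 hwa, fun b hb ξ hξ => ?_, fun n ξ hξ hωξ => ?_⟩
  · have hqb := h.of_lt hb ha
    have hqξ := h.of_lt (hξ.trans_lt hb) ha
    obtain ⟨z, hz, hmaps⟩ := hp hξ (hb.trans ho) (x := ⟨_, hqξ⟩) (y := ⟨_, hqb⟩) rfl rfl
    exact (mem_iff_lt hz ha).1 (hclosed ⟨_, hqb⟩ ((mem_iff_lt rfl ha).2 hb) ⟨_, hqξ⟩
      ((memOrEq_iff_le rfl rfl).2 hξ) z hmaps)
  · have hqξ := h.of_lt hξ ha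
    have hsucc : IsSucc (⟨_, hnat (n + 1)⟩ : Subtype q) ⟨_, hnat n⟩ := fun x => by
      change x.1 ∈ ((n + 1 : ℕ) : Ordinal.{u}).toZFSet ↔ x.1 ∈ (n : Ordinal.{u}).toZFSet ∨ _
      rw [Nat.cast_add_one, toZFSet_add_one, ZFSet.mem_insert_iff, or_comm, Subtype.ext_iff]
    obtain ⟨z, hz, hmaps⟩ := hp hξ.le ho (x := ⟨_, hqξ⟩) rfl ha
    have := hiff _ (hmem_w n) _ (hmem_w (n + 1)) hsucc _ _ (hG n _ rfl) (hG (n + 1) _ rfl)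
      ⟨_, hqξ⟩ ((mem_iff_lt rfl ha).2 hξ) ((memOrEq_iff_le hw rfl).2 hωξ) z hmaps
    rwa [mem_ofPred_eq, ← hz]

theorem endHomogeneous {o : Ordinal.{u}} {p w ν : Subtype q} (hp : Computes p π o)
    (hν : ν.1 = o.toZFSet) (hw : w.1 = toZFSet ω) (hom : EndHomogeneousIn p w ν) :
    EndHomogeneous π o := by
  intro F
  obtain ⟨F', hF'⟩ := h.exists_sep (fun x => ∃ ξ ∈ F, x.1 = ξ.toZFSet) ν
  obtain ⟨s, X, hsub, hgt, hat, hseq, hzero⟩ := hom F' fun x hx => ((hF' x).1 hx).1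
  have hq {a} (ha : a < o) : q a.toZFSet := h.of_lt ha hν
  have hnat (n : ℕ) : q (n : Ordinal.{u}).toZFSet := h.of_lt (natCast_lt_omega0 n) hw
  have hmem_w (n : ℕ) : ⟨_, hnat n⟩ ∈ w := (mem_iff_lt rfl hw).2 (natCast_lt_omega0 n)
  choose G hG using fun n => hseq _ (hmem_w n)
  have hX {a : Ordinal.{u}} (ha : a.toZFSet ∈ X.1) : a < o :=
    (mem_iff_lt rfl hν).1 (hsub ⟨_, h.of_mem ha X.2⟩ ha)
  refine ⟨fun n => {ξ | ξ.toZFSet ∈ (G n).1}, {a | a.toZFSet ∈ X.1}, fun a => hX,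
    fun b hb => ?_, fun a ha => ?_, fun ξ hξ hωξ => ?_⟩
  · obtain ⟨a, ha, hba⟩ := hgt ⟨_, hq hb⟩ ((mem_iff_lt rfl hν).2 hb)
    obtain ⟨α, -, haα⟩ := exists_lt_of_mem hν (hsub a ha)
    exact ⟨α, (haα ▸ ha : α.toZFSet ∈ X.1), (mem_iff_lt rfl haα).1 hba⟩
  · refine h.endHomogeneousAt hp (hX ha) rfl hw (fun n k hk => ?_)
      (hat ⟨a.toZFSet, h.of_mem ha X.2⟩ ha)
    rw [show k = ⟨_, hnat n⟩ from Subtype.ext hk]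
    exact hG n
  · have hempty (x : Subtype q) : x ∉ (⟨_, hnat 0⟩ : Subtype q) := fun hx => by
      obtain ⟨a, ha, -⟩ := exists_lt_of_mem rfl hx
      exact not_lt_zero ((Nat.cast_zero (R := Ordinal.{u})) ▸ ha)
    refine (hzero _ (hmem_w 0) hempty _ (hG 0) ⟨_, hq hξ⟩ ((mem_iff_lt rfl hν).2 hξ)
      ((memOrEq_iff_le hw rfl).2 hωξ)).trans ?_
    rw [hF']
    refine ⟨?_, fun hξF => ⟨(mem_iff_lt rfl hν).2 hξ, ξ, hξF, rfl⟩⟩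
    rintro ⟨-, η, hη, heq⟩
    rwa [toZFSet_injective heq]

theorem exists_isRamsey {o o' : Ordinal.{u}} {p w ν c : Subtype q} (hp : IsPairingIn p c)
    (hc : c.1 = o'.toZFSet) (hν : ν.1 = o.toZFSet) (hw : w.1 = toZFSet ω) (h0 : 0 < o)
    (ho : o ≤ o') (hom : EndHomogeneousIn p w ν) : ∃ κ : Cardinal.{u}, κ.ord = o ∧ IsRamsey κ := by
  obtain ⟨π, hπ, hcomp⟩ := h.exists_computes hc hp
  have hπo := hπ.mono ho
  have hEH : EndHomogeneous π o :=
    h.endHomogeneous (fun _ _ hξ ha => hcomp hξ (ha.trans_le ho)) hν hw hom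
  have hcof : o.cof.ord = o := hEH.ord_cof hπo
  rw [← hcof] at hEH hπo h0
  exact ⟨o.cof, hcof, hEH.isRamsey hπo (ord_pos.1 h0)⟩

end Ambient

/-! ### Powerset preserving embeddings -/

/-- A countably closed model `M` elementary in a class `q` like `H(θ)`, with a `κ`-powerset
preserving elementary embedding `j : M → N`. -/
structure PreservingSetting (κ : Cardinal.{u}) {q : ZFSet.{u} → Prop} {M N : ZFSet.{u}}
    (i : M ↪ₑ[setLang] Subtype q) (j : M ↪ₑ[setLang] N) : Prop where
  ambient : Ambient q
  aleph0_lt : ℵ₀ < κ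
  coe_eq : ∀ x : M, (i x).1 = x.1
  succ_subset : insert (cardSet κ) (cardSet κ) ⊆ M
  closed : ClosedUnderSeq (aleph 1) M
  preserving : IsPowersetPreserving κ j

namespace PreservingSetting

open ZFSet

variable {κ : Cardinal.{u}} {q : ZFSet.{u} → Prop} {M N : ZFSet.{u}}
  {i : M ↪ₑ[setLang] Subtype q} {j : M ↪ₑ[setLang] N} (h : PreservingSetting κ i j)
include h

theorem omega_lt : ω < κ.ord := omega0_lt_ord.2 h.aleph0_lt

theorem toZFSet_mem {o : Ordinal.{u}} (ho : o ≤ κ.ord) : o.toZFSet ∈ M := by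
  refine h.succ_subset (ZFSet.mem_insert_iff.2 ?_)
  obtain ho | rfl := ho.lt_or_eq
  · exact .inr (toZFSet_mem_toZFSet_iff.2 ho)
  · exact .inl rfl

theorem fixes {o : Ordinal.{u}} (ho : o < κ.ord) {x : M} (hx : x.1 = o.toZFSet) :
    (j x).1 = o.toZFSet :=
  (h.preserving.fixes x (hx ▸ toZFSet_mem_toZFSet_iff.2 ho)).trans hx

theorem subset_of_mem_subsetsIn {x : ZFSet.{u}} (hx : x ∈ subsetsIn M κ) : x ⊆ cardSet κ := by
  have hsub := (IsFirstOrder.map_iff (fun q (v : Fin 2 → Subtype q) => ∀ y ∈ v 0, y ∈ v 1) i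
    ![⟨x, hx.1⟩, ⟨_, h.toZFSet_mem le_rfl⟩]).1 fun y hy => hx.2 y.1 y.2 hy
  intro y hy
  have hyx : y ∈ (i ⟨x, hx.1⟩).1 := (h.coe_eq ⟨x, hx.1⟩).symm ▸ hy
  have hyc : y ∈ (i ⟨cardSet κ, _⟩).1 := hsub ⟨y, h.ambient.of_mem hyx (i _).2⟩ hyx
  rwa [h.coe_eq] at hyc

theorem mem_target {x : ZFSet.{u}} (hx : x ∈ M) (hxκ : x ⊆ cardSet κ) : x ∈ N :=
  (h.preserving.same_subsets ▸ ⟨hx, fun _ _ hy => hxκ hy⟩ : x ∈ subsetsIn N κ).1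

theorem mem_source {x : ZFSet.{u}} (hx : x ∈ N) (hxκ : ∀ y ∈ N, y ∈ x → y ∈ cardSet κ) :
    x ∈ M :=
  (h.preserving.same_subsets ▸ ⟨hx, hxκ⟩ : x ∈ subsetsIn M κ).1

theorem cardSet_mem_target : cardSet κ ∈ N := h.mem_target (h.toZFSet_mem le_rfl) fun _ hx => hx

section Kappa

variable {c : M} {k : N} (hc : c.1 = cardSet κ) (hk : k.1 = cardSet κ)
include hc hk

theorem exists_eq_map {x : N} (hx : x ∈ k) : ∃ y ∈ c, y.1 = x.1 ∧ j y = x := by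
  obtain ⟨o, ho, hxo⟩ := exists_lt_of_mem hk hx
  let y : M := ⟨_, h.toZFSet_mem ho.le⟩
  exact ⟨y, (mem_iff_lt rfl hc).2 ho, hxo.symm, Subtype.ext ((h.fixes ho rfl).trans hxo.symm)⟩

theorem map_mem {x : M} (hx : x ∈ c) : j x ∈ k := by
  obtain ⟨o, ho, hxo⟩ := exists_lt_of_mem hc hx
  exact (mem_iff_lt (h.fixes ho hxo) hk).2 ho

theorem mem_map : k ∈ j c := by
  have htri : ∀ a b : N, IsOrd a → IsOrd b → a ∈ b ∨ a = b ∨ b ∈ a := by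
    let P (q : ZFSet.{u} → Prop) (_ : Fin 0 → Subtype q) : Prop :=
      ∀ a b : Subtype q, IsOrd a → IsOrd b → a ∈ b ∨ a = b ∨ b ∈ a
    have hP : IsFirstOrder P := by unfold P; infer_instance
    refine (IsFirstOrder.map_iff P j ![]).1 ((IsFirstOrder.map_iff P i ![]).2 fun a b ha hb => ?_)
    rw [Subtype.ext_iff]
    exact (h.ambient.isOrd_iff.1 ha).mem_trichotomous (h.ambient.isOrd_iff.1 hb)
  have hκ : (cardSet κ).IsOrdinal := isOrdinal_toZFSet _
  have hjc : IsOrd (j c) := by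
    rwa [isOrd_map_iff j, ← isOrd_map_iff i, h.ambient.isOrd_iff, h.coe_eq, hc]
  have hk' : IsOrd k := by
    rw [← hk] at hκ
    exact ⟨fun x hx y hy => hκ.mem_trans hy hx,
      fun x hx y hy z hz => (hκ.mem hx).mem_trans hz hy⟩
  obtain hmem | heq | hmem := htri k (j c) hk' hjc
  · exact hmem
  · exact absurd (heq ▸ hk.trans hc.symm) (h.preserving.moves c hc)
  · obtain ⟨x, hx, -, hxc⟩ := h.exists_eq_map hc hk hmem
    exact absurd (j.injective hxc ▸ hx) (ZFSet.mem_irrefl c.1)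

omit hk in
theorem exists_isPairingIn : ∃ p : M, IsPairingIn p c := by
  refine (IsFirstOrder.map_iff (fun q (v : Fin 1 → Subtype q) => ∃ p, IsPairingIn p (v 0)) i
    ![c]).2 ?_
  exact h.ambient.exists_isPairingIn h.aleph0_lt.le ((h.coe_eq c).trans hc)

end Kappa

section Derivatives

variable {c w p : M} {k : N} (hc : c.1 = cardSet κ) (hw : w.1 = toZFSet ω)
  (hk : k.1 = cardSet κ) (hp : IsPairingIn p c)

include hc hk in
theorem exists_derivative (p F : M) : ∃ D : M,
    ∀ ξ ∈ c, ξ ∈ D ↔ ∃ z ∈ j F, Maps (j p) (j ξ) k z := by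
  let P (q : ZFSet.{u} → Prop) (_ : Fin 0 → Subtype q) : Prop :=
    ∀ c p F : Subtype q, ∃ D : Subtype q, ∀ x, x ∈ D ↔ x ∈ c ∧ ∃ z ∈ F, Maps p x c z
  have hP : IsFirstOrder P := by unfold P; infer_instance
  obtain ⟨D, hD⟩ := (IsFirstOrder.map_iff P j ![]).1
    ((IsFirstOrder.map_iff P i ![]).2 fun c p F =>
      h.ambient.exists_sep (fun x => ∃ z ∈ F, Maps p x c z) c) k (j p) (j F)
  have hDM : D.1 ∈ M := h.mem_source D.2 fun y hy hyD => hk ▸ ((hD ⟨y, hy⟩).1 hyD).1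
  refine ⟨⟨D.1, hDM⟩, fun ξ hξ => ?_⟩
  have hfix : (j ξ).1 = ξ.1 := h.preserving.fixes ξ (hc ▸ hξ)
  have := hD (j ξ)
  rw [and_iff_right (h.map_mem hc hk hξ)] at this
  change (j ξ).1 ∈ D.1 ↔ _ at this
  rwa [hfix] at this

theorem exists_seq (G : ℕ → M) : ∃ s : M, ∀ (n : ℕ) (k : M),
    k.1 = toZFSet n → ∀ y, Relates s k y ↔ y = G n := by
  let s : ZFSet.{u} := ZFSet.sep (fun z => ∃ n : ℕ, z = pair (toZFSet n) (G n).1)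
    ((toZFSet ω).prod M)
  have hs (x y : ZFSet.{u}) : pair x y ∈ s ↔ ∃ n : ℕ, x = toZFSet n ∧ y = (G n).1 := by
    rw [ZFSet.mem_sep, pair_mem_prod]
    constructor
    · rintro ⟨-, n, hn⟩
      exact ⟨n, pair_inj.1 hn⟩
    · rintro ⟨n, rfl, rfl⟩
      exact ⟨⟨toZFSet_mem_toZFSet_iff.2 (natCast_lt_omega0 n), (G n).2⟩, n, rfl⟩
  have hsM : s ∈ M := by
    refine h.closed ω (omega0_lt_ord.2 aleph0_lt_aleph_one) s ⟨ZFSet.sep_subset, fun z hz => ?_⟩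
    obtain ⟨m, hm, rfl⟩ := mem_toZFSet_iff.1 hz
    obtain ⟨n, rfl⟩ := lt_omega0.1 hm
    refine ⟨(G n).1, (hs _ _).2 ⟨n, rfl, rfl⟩, fun y hy => ?_⟩
    obtain ⟨n', hn, rfl⟩ := (hs _ _).1 hy
    rw [Nat.cast_injective (toZFSet_injective hn)]
  refine ⟨⟨s, hsM⟩, fun n k hk y => ?_⟩
  rw [← relates_map_iff i, h.ambient.relates_iff, h.coe_eq, h.coe_eq, h.coe_eq, hs, Subtype.ext_iff]
  constructor
  · rintro ⟨n', hn', hy⟩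
    rwa [Nat.cast_injective (toZFSet_injective (hk.symm.trans hn'))]
  · exact fun hy => ⟨n, hk, hy⟩

include hc hk hp in
theorem maps_mem {b ξ z : N} (hb : b ∈ k) (hξ : MemOrEq ξ b) (hz : Maps (j p) ξ b z) :
    z ∈ k := by
  have hξk : ξ ∈ k := by
    obtain ⟨o, ho, hbo⟩ := exists_lt_of_mem hk hb
    obtain ⟨η, hη, hξη⟩ := exists_le_of_memOrEq hbo hξ
    exact (mem_iff_lt hξη hk).2 (hη.trans_lt ho)
  obtain ⟨b, hbc, -, rfl⟩ := h.exists_eq_map hc hk hb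
  obtain ⟨ξ, -, -, rfl⟩ := h.exists_eq_map hc hk hξk
  have hξ' : MemOrEq ξ b := hξ.imp (map_mem_map_iff j).1 fun e => j.injective e
  obtain ⟨z₀, hz₀, -, hmaps, -⟩ := hp.1 b hbc ξ hξ'
  have hjp : IsPairingIn (j p) (j c) := (isPairingIn_map_iff j).2 hp
  rw [hjp.maps_unique ((map_mem_map_iff j).2 hbc) hξ hz ((maps_map_iff j).2 hmaps)]
  exact h.map_mem hc hk hz₀

include hc hw hk hp in
/-- The ordinal `κ` is end-homogeneous for the image under `j` of a sequence of iterated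
derivatives, since the fiber over `κ` of `j (G n)` is `G (n + 1)`. -/
theorem endHomogeneousAtIn_map {G : ℕ → M}
    (hG : ∀ n, ∀ ξ ∈ c, ξ ∈ G (n + 1) ↔ ∃ z ∈ j (G n), Maps (j p) (j ξ) k z) {s : M}
    (hs : ∀ (n : ℕ) (k : M), k.1 = toZFSet n → ∀ y, Relates s k y ↔ y = G n) :
    EndHomogeneousAtIn (j p) (j w) (j s) k := by
  have hjp : IsPairingIn (j p) (j c) := (isPairingIn_map_iff j).2 hp
  have hjw : (j w).1 = toZFSet ω := h.fixes h.omega_lt hw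
  have hnat_lt (n : ℕ) : (n : Ordinal.{u}) < κ.ord := (natCast_lt_omega0 n).trans h.omega_lt
  have hnat {m : N} (hm : m ∈ j w) : ∃ (n : ℕ) (m₀ : M), m₀.1 = toZFSet n ∧ j m₀ = m := by
    obtain ⟨n, hmn⟩ := exists_nat_of_mem hjw hm
    exact ⟨n, ⟨_, h.toZFSet_mem (hnat_lt n).le⟩, rfl,
      Subtype.ext ((h.fixes (hnat_lt n) rfl).trans hmn.symm)⟩
  have hval {m : M} {n : ℕ} (hm : m.1 = toZFSet n) {y : N} (hy : Relates (j s) (j m) y) :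
      y = j (G n) :=
    (IsFirstOrder.map_iff (fun q (v : Fin 3 → Subtype q) => ∀ y, Relates (v 0) (v 1) y → y = v 2)
      j ![s, m, G n]).1 (fun y hy => (hs n m hm y).1 hy) y hy
  refine ⟨(mem_iff_lt hjw hk).2 h.omega_lt, fun b hb ξ hξ z hz => h.maps_mem hc hk hp hb hξ hz, ?_⟩
  intro m hm m' hm' hsucc A A' hA hA' ξ hξ _ z hz
  obtain ⟨n, m, hmn, rfl⟩ := hnat hm
  obtain ⟨n', m', hmn', rfl⟩ := hnat hm'
  obtain rfl : n' = n + 1 := by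
    refine Nat.cast_injective (R := Ordinal.{u}) ?_
    rw [((isSucc_map_iff j).1 hsucc).eq_add_one hmn hmn', Nat.cast_add_one]
    exact_mod_cast h.toZFSet_mem (hnat_lt (n + 1)).le
  obtain ⟨ξ, hξc, -, rfl⟩ := h.exists_eq_map hc hk hξ
  rw [hval hmn hA, hval hmn' hA', map_mem_map_iff, hG n ξ hξc]
  refine ⟨fun hzG => ⟨z, hzG, hz⟩, ?_⟩
  rintro ⟨z', hz', hmaps⟩
  rwa [hjp.maps_unique (h.mem_map hc hk) (.inl hξ) hz hmaps]

include hc hw hk hp in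
theorem exists_isEndHomogeneousForIn (F : M) : ∃ s X, IsEndHomogeneousForIn p w c F s X := by
  choose d hd using h.exists_derivative hc hk p
  let G : ℕ → M := fun n => d^[n] F
  obtain ⟨s, hs⟩ := h.exists_seq G
  obtain ⟨X, hX⟩ : ∃ X : M, ∀ a, a ∈ X ↔ a ∈ c ∧ EndHomogeneousAtIn p w s a := by
    refine (IsFirstOrder.map_iff (fun q (v : Fin 4 → Subtype q) => ∃ X : Subtype q,
      ∀ a, a ∈ X ↔ a ∈ v 0 ∧ EndHomogeneousAtIn (v 1) (v 2) (v 3) a) i ![c, p, w, s]).2 ?_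
    exact h.ambient.exists_sep (EndHomogeneousAtIn (i p) (i w) (i s)) (i c)
  have hkX : k ∈ j X := by
    refine ((IsFirstOrder.map_iff (fun q (v : Fin 5 → Subtype q) => ∀ a, a ∈ v 4 ↔ a ∈ v 0 ∧
      EndHomogeneousAtIn (v 1) (v 2) (v 3) a) j ![c, p, w, s, X]).1 hX k).2 ⟨h.mem_map hc hk, ?_⟩
    refine h.endHomogeneousAtIn_map hc hw hk hp (G := G) (fun n => ?_) hs
    rw [show G (n + 1) = d (G n) from Function.iterate_succ_apply' d n F]
    exact hd (G n)
  refine ⟨s, X, fun a ha => ((hX a).1 ha).1, fun b hb => ?_, fun a ha => ((hX a).1 ha).2,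
    fun m hm => ?_, fun e he hempty A hA ξ _ _ => ?_⟩
  · exact (IsFirstOrder.map_iff (fun q (v : Fin 2 → Subtype q) => ∃ a ∈ v 0, v 1 ∈ a) j
      ![X, b]).2 ⟨k, hkX, h.map_mem hc hk hb⟩
  · obtain ⟨n, hn⟩ := exists_nat_of_mem hw hm
    exact ⟨G n, (hs n m hn _).2 rfl⟩
  · obtain ⟨n, hn⟩ := exists_nat_of_mem hw he
    obtain rfl | hpos := n.eq_zero_or_pos
    · rw [(hs 0 e hn A).1 hA]
      rfl
    · have hpos' : (0 : Ordinal.{u}) < n := mod_cast hpos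
      exact absurd ((mem_iff_lt rfl hn).2 hpos')
        (hempty ⟨_, h.toZFSet_mem (zero_le (a := κ.ord))⟩)

include hc hw hk hp in
theorem endHomogeneousIn : EndHomogeneousIn p w c :=
  fun F _ => h.exists_isEndHomogeneousForIn hc hw hk hp F

include hc hw hk hp in
theorem endHomogeneousIn_target : EndHomogeneousIn (j p) (j w) k := by
  intro F hF
  have hFM : F.1 ∈ M := h.mem_source F.2 fun y hy hyF => hk ▸ hF ⟨y, hy⟩ hyF
  obtain ⟨s, X, hX⟩ := h.exists_isEndHomogeneousForIn hc hw hk hp ⟨F.1, hFM⟩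
  have hXκ : X.1 ⊆ cardSet κ :=
    h.subset_of_mem_subsetsIn ⟨X.2, fun y hy hyX => hc ▸ hX.1 ⟨y, hy⟩ hyX⟩
  have hXk {a : N} (ha : a.1 ∈ X.1) : a ∈ k := by
    change a.1 ∈ k.1
    rw [hk]
    exact hXκ ha
  obtain ⟨-, -, hat, hseq, hzero⟩ := (isEndHomogeneousForIn_map_iff j).2 hX
  have hfix {x : M} (hx : x ∈ c) : (j x).1 = x.1 := h.preserving.fixes x (hc ▸ hx)
  refine ⟨j s, ⟨X.1, h.mem_target X.2 hXκ⟩, fun a => hXk, fun b hb => ?_,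
    fun a ha => ?_, hseq, fun e he hempty A hA ξ hξ hwξ => ?_⟩
  · obtain ⟨b, hbc, -, rfl⟩ := h.exists_eq_map hc hk hb
    obtain ⟨a, ha, hba⟩ := hX.2.1 b hbc
    exact ⟨j a, ((hfix (hX.1 a ha)).symm ▸ ha : (j a).1 ∈ X.1), (map_mem_map_iff j).2 hba⟩
  · obtain ⟨a', -, haa', rfl⟩ := h.exists_eq_map hc hk (hXk ha)
    exact hat _ ((map_mem_map_iff j).2 (haa' ▸ ha : a'.1 ∈ X.1))
  · obtain ⟨ξ, hξc, -, rfl⟩ := h.exists_eq_map hc hk hξ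
    rw [hzero e he hempty A hA _ ((map_mem_map_iff j).2 hξc) hwξ, map_mem_map_iff]
    change ξ.1 ∈ F.1 ↔ (j ξ).1 ∈ F.1
    rw [hfix hξc]

end Derivatives

theorem isRamsey : IsRamsey κ := by
  let c : M := ⟨cardSet κ, h.toZFSet_mem le_rfl⟩
  let w : M := ⟨toZFSet ω, h.toZFSet_mem h.omega_lt.le⟩
  obtain ⟨p, hp⟩ := h.exists_isPairingIn (c := c) rfl
  have hom : EndHomogeneousIn p w c :=
    h.endHomogeneousIn (k := ⟨_, h.cardSet_mem_target⟩) rfl rfl rfl hp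
  obtain ⟨κ', hκ', hR⟩ := h.ambient.exists_isRamsey ((isPairingIn_map_iff i).2 hp) (h.coe_eq c)
    (h.coe_eq c) (h.coe_eq w) (omega0_pos.trans h.omega_lt) le_rfl
    ((endHomogeneousIn_map_iff i).2 hom)
  exact ord_injective hκ' ▸ hR

theorem exists_isRamsey_lt {μ : Cardinal.{u}} (hμ : μ < κ) :
    ∃ ν, μ < ν ∧ ν < κ ∧ IsRamsey ν := by
  let c : M := ⟨cardSet κ, h.toZFSet_mem le_rfl⟩
  let w : M := ⟨toZFSet ω, h.toZFSet_mem h.omega_lt.le⟩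
  let m : M := ⟨_, h.toZFSet_mem (ord_lt_ord.2 hμ).le⟩
  let k : N := ⟨cardSet κ, h.cardSet_mem_target⟩
  obtain ⟨p, hp⟩ := h.exists_isPairingIn (c := c) rfl
  have hmc : m ∈ c := toZFSet_mem_toZFSet_iff.2 (ord_lt_ord.2 hμ)
  have hN : ∃ ν ∈ j c, j m ∈ ν ∧ EndHomogeneousIn (j p) (j w) ν :=
    ⟨k, h.mem_map rfl rfl, h.map_mem rfl rfl hmc,
      h.endHomogeneousIn_target rfl rfl rfl hp⟩
  obtain ⟨ν, hν, hmν, hom⟩ := (IsFirstOrder.map_iff (fun q (v : Fin 4 → Subtype q) =>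
    ∃ ν ∈ v 0, v 1 ∈ ν ∧ EndHomogeneousIn (v 2) (v 3) ν) j ![c, m, p, w]).2 hN
  obtain ⟨o, ho, hνo⟩ := exists_lt_of_mem (o := κ.ord) rfl hν
  have hμo : μ.ord < o := (mem_iff_lt rfl hνo).1 hmν
  obtain ⟨κ', rfl, hR⟩ := h.ambient.exists_isRamsey ((isPairingIn_map_iff i).2 hp) (h.coe_eq c)
    ((h.coe_eq ν).trans hνo) (h.coe_eq w) (zero_le.trans_lt hμo) ho.le
    ((endHomogeneousIn_map_iff i).2 hom)
  exact ⟨κ', ord_lt_ord.1 hμo, ord_lt_ord.1 ho, hR⟩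

end PreservingSetting

end LargeCardinal

open LargeCardinal Cardinal FirstOrder in
theorem proposition5p4_general {κ θ : Cardinal.{u}} (hκ : ℵ₀ < κ) (hθ : ℵ₀ ≤ θ) {M N : ZFSet.{u}}
    (hM : insert (cardSet κ) (cardSet κ) ⊆ M) (hMθ : IsElementarySubmodel M (H θ))
    (hcl : ClosedUnderSeq (aleph 1) M) {j : M ↪ₑ[setLang] N} (hj : IsPowersetPreserving κ j) :
    IsRamsey κ ∧ ∀ μ < κ, ∃ ν, μ < ν ∧ ν < κ ∧ IsRamsey ν := by
  obtain ⟨i, hi⟩ := hMθ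
  have h : PreservingSetting κ i j := ⟨ambient_H hθ, hκ, hi, hM, hcl, hj⟩
  exact ⟨h.isRamsey, fun _ => h.exists_isRamsey_lt⟩

theorem proposition5p4 (κ : Cardinal.{u})
    (hκ : LargeCardinal.IsAlphaRamsey (Cardinal.aleph 1) κ) :
    LargeCardinal.IsRamsey κ ∧
      ∀ μ : Cardinal.{u}, μ < κ →
        ∃ ν : Cardinal.{u}, μ < ν ∧ ν < κ ∧ LargeCardinal.IsRamsey ν := by
  obtain ⟨θ, -, hθ, h⟩ := hκ.exists_embedding κ
  obtain ⟨M, -, hM, hMθ, hcl, N, j, hj⟩ := h ∅ (ZFSet.empty_subset _)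
  exact proposition5p4_general (Cardinal.aleph0_lt_aleph_one.trans_le hκ.le)
    hθ.aleph0_le hM.succ_subset hMθ hcl hj
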